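/- Let $S$ be a densely defined symmetric operator in a complex Hilbert space $\mathcal H$, and let $(\mathcal G,\Gamma_1,\Gamma_2)$ be a boundary triple for its adjoint $S^*$: $\mathcal G$ is a complex Hilbert space and $\Gamma_1,\Gamma_2:\operatorname{dom}S^*\to\mathcal G$ are linear maps such that $\langle f, S^*g\rangle-\langle S^*f, g\rangle=\langle\Gamma_1f,\Gamma_2g\rangle-\langle\Gamma_2f,\Gamma_1g\rangle$ for all $f,g\in\operatorname{dom}S^*$, the map $(\Gamma_1,\Gamma_2):\operatorname{dom}S^*\to\mathcal G\oplus\mathcal G$ is surjective, and $\ker(\Gamma_1,\Gamma_2)$ is dense in $\mathcal H$. (The deficiency indices of $S$ are then equal.) Let $H^0$ be the restriction of $S^*$ to $\ker\Gamma_1$. For $z$ in the resolvent set $\operatorname{res}H^0$ let $\gamma(z):\mathcal G\to\ker(S^*-z)\subset\mathcal H$ be the bounded inverse of the restriction of $\Gamma_1$ to $\ker(S^*-z)$, and let $Q(z):=\Gamma_2\gamma(z)$, a bounded operator in $\mathcal G$. Let $\Lambda$ be a (possibly unbounded) self-adjoint operator in $\mathcal G$, and let $H_\Lambda$ be the restriction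 of $S^*$ to $\ker(\Gamma_2-\Lambda\Gamma_1)=\{f\in\operatorname{dom}S^*:\ \Gamma_1f\in\operatorname{dom}\Lambda,\ \Gamma_2f=\Lambda\Gamma_1f\}$. For an operator $A$ with spectrum $\operatorname{spec}A=\mathbb C\setminus\operatorname{res}A$, let $\operatorname{spec}_{\mathrm{pp}}A$ be the set of all eigenvalues of $A$, let $\operatorname{spec}_{\mathrm{dis}}A$ be the set of the eigenvalues of finite multiplicity that are isolated points of $\operatorname{spec}A$, and let $\operatorname{spec}_{\mathrm{ess}}A=\operatorname{spec}A\setminus\operatorname{spec}_{\mathrm{dis}}A$. Then for each $\bullet\in\{\mathrm{pp},\mathrm{dis},\mathrm{ess}\}$ $$\operatorname{spec}_\bullet H_\Lambda\setminus\operatorname{spec}H^0=\big\{E\in\operatorname{res}H^0:\ 0\in\operatorname{spec}_\bullet\big(Q(E)-\Lambda\big)\big\}.$$ Moreover, for every $E\in\operatorname{res}H^0$ the map $\gamma(E)$ is injective and $\ker(H_\Lambda-E)=\gamma(E)\ker\big(Q(E)-\Lambda\big)$; in particular $\dim\ker(H_\Lambda-E)=\dim\ker\big(Q(E)-\Lambda\big)$,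 i.e. the multiplicities coincide. -/

import Mathlib

/-!
Spectra of unbounded operators in complex Hilbert spaces, boundary triples, and the induced
Krein `Γ`-field and `𝒬`-function.
-/

noncomputable section

namespace LinearPMap

variable {H : Type*} [NormedAddCommGroup H] [InnerProductSpace ℂ H]

/-- The resolvent set of `A`: those `z` for which `A - z : dom A → H` has an everywhere defined
bounded (two-sided) inverse `R`. -/
def resolventSet (A : H →ₗ.[ℂ] H) : Set ℂ :=
  {z | ∃ R : H →L[ℂ] H,
    (∀ y : H, ∃ h : R y ∈ A.domain, A ⟨R y, h⟩ - z • R y = y) ∧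
    (∀ x : A.domain, R (A x - z • (x : H)) = x)}

/-- The spectrum of `A`. -/
def spec (A : H →ₗ.[ℂ] H) : Set ℂ := A.resolventSetᶜ

/-- `ker (A - z)` as a subspace of `dom A`. -/
def kerSub (A : H →ₗ.[ℂ] H) (z : ℂ) : Submodule ℂ A.domain :=
  LinearMap.ker (A.toFun - z • A.domain.subtype)

/-- `ker (A - z)` as a subspace of `H`. -/
def eigenspace (A : H →ₗ.[ℂ] H) (z : ℂ) : Submodule ℂ H :=
  (A.kerSub z).map A.domain.subtype

/-- The pure point spectrum: the set of all eigenvalues (no closure is taken). -/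
def specPP (A : H →ₗ.[ℂ] H) : Set ℂ := {z | A.eigenspace z ≠ ⊥}

/-- The discrete spectrum: eigenvalues of finite multiplicity that are isolated points of the
spectrum. -/
def specDis (A : H →ₗ.[ℂ] H) : Set ℂ :=
  {z | z ∈ A.specPP ∧ FiniteDimensional ℂ (A.eigenspace z) ∧
    ∃ ε : ℝ, 0 < ε ∧ ∀ w ∈ A.spec, dist w z < ε → w = z}

/-- The essential spectrum: the complement of the discrete spectrum in the spectrum. -/
def specEss (A : H →ₗ.[ℂ] H) : Set ℂ := A.spec \ A.specDis

/-- The restriction of `A` to a subspace `K` of its domain. -/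
def restrictTo (A : H →ₗ.[ℂ] H) (K : Submodule ℂ A.domain) : H →ₗ.[ℂ] H :=
  A.domRestrict (K.map A.domain.subtype)

theorem mem_kerSub {A : H →ₗ.[ℂ] H} {z : ℂ} {x : A.domain} :
    x ∈ A.kerSub z ↔ A x = z • (x : H) := by
  simp [kerSub, LinearMap.mem_ker, sub_eq_zero]

theorem mem_restrictTo_domain {A : H →ₗ.[ℂ] H} {K : Submodule ℂ A.domain} {x : H} :
    x ∈ (A.restrictTo K).domain ↔ ∃ h : x ∈ A.domain, (⟨x, h⟩ : A.domain) ∈ K := by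
  simp [restrictTo]

theorem restrictTo_apply {A : H →ₗ.[ℂ] H} {K : Submodule ℂ A.domain}
    (x : (A.restrictTo K).domain) (y : A.domain) (h : (x : H) = y) :
    A.restrictTo K x = A y :=
  domRestrict_apply h

end LinearPMap

/-- A boundary triple `(G, Γ₁, Γ₂)` for a closed linear operator `A` in `H`. -/
structure BoundaryTriple {H : Type*} [NormedAddCommGroup H] [InnerProductSpace ℂ H]
    (A : H →ₗ.[ℂ] H) (G : Type*) [NormedAddCommGroup G] [InnerProductSpace ℂ G] where
  isClosed : A.IsClosed
  Γ₁ : A.domain →ₗ[ℂ] G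
  Γ₂ : A.domain →ₗ[ℂ] G
  green : ∀ f g : A.domain,
    inner ℂ (f : H) (A g) - inner ℂ (A f) (g : H) =
      inner ℂ (Γ₁ f) (Γ₂ g) - inner ℂ (Γ₂ f) (Γ₁ g)
  surjective : Function.Surjective fun f : A.domain => (Γ₁ f, Γ₂ f)
  dense_ker : Dense {x : H | ∃ h : x ∈ A.domain, Γ₁ ⟨x, h⟩ = 0 ∧ Γ₂ ⟨x, h⟩ = 0}

namespace BoundaryTriple

variable {H : Type*} [NormedAddCommGroup H] [InnerProductSpace ℂ H] {A : H →ₗ.[ℂ] H}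
  {G : Type*} [NormedAddCommGroup G] [InnerProductSpace ℂ G]

/-- `H⁰`, the restriction of `A` to `ker Γ₁`. -/
def opZero (T : BoundaryTriple A G) : H →ₗ.[ℂ] H :=
  A.restrictTo (LinearMap.ker T.Γ₁)

/-- `H_Λ`, the restriction of `A` to `ker (Γ₂ - Λ Γ₁)`, i.e. to those `f ∈ dom A` with
`Γ₁ f ∈ dom Λ` and `Γ₂ f = Λ (Γ₁ f)`. -/
def opRel (T : BoundaryTriple A G) (Λ : G →ₗ.[ℂ] G) : H →ₗ.[ℂ] H :=
  A.restrictTo (Λ.graph.comap (T.Γ₁.prod T.Γ₂))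

variable (T : BoundaryTriple A G) {z : ℂ}

/-- The only element of `ker (A - z) ∩ dom H⁰` is zero. -/
theorem eq_zero_of_mem_ker (hz : z ∈ T.opZero.resolventSet) (f : A.domain)
    (hf : f ∈ A.kerSub z) (h0 : T.Γ₁ f = 0) : f = 0 := by
  obtain ⟨R, -, hR⟩ := hz
  have hm : (f : H) ∈ T.opZero.domain :=
    LinearPMap.mem_restrictTo_domain.2 ⟨f.2, by simpa using h0⟩
  have h1 := hR ⟨f, hm⟩
  have h2 : T.opZero ⟨f, hm⟩ = A f := LinearPMap.restrictTo_apply _ f rfl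
  rw [h2, LinearPMap.mem_kerSub.1 hf] at h1
  simpa using h1.symm

/-- For `z` in the resolvent set of `H⁰`, the map `Γ₁ : ker (A - z) → G` is a bijection. -/
theorem bijective_restrict (hz : z ∈ T.opZero.resolventSet) :
    Function.Bijective (T.Γ₁.domRestrict (A.kerSub z)) := by
  constructor
  · rw [injective_iff_map_eq_zero]
    rintro ⟨f, hf⟩ h
    exact Subtype.ext (T.eq_zero_of_mem_ker hz f hf h)
  · intro x
    obtain ⟨f, hf⟩ := T.surjective (x, 0)
    obtain ⟨R, hR, -⟩ := id hz
    obtain ⟨hm, he⟩ := hR (A f - z • (f : H))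
    obtain ⟨hA, hK⟩ := LinearPMap.mem_restrictTo_domain.1 hm
    have h2 : T.opZero ⟨_, hm⟩ = A ⟨_, hA⟩ := LinearPMap.restrictTo_apply _ _ rfl
    rw [h2] at he
    refine ⟨⟨f - ⟨_, hA⟩, ?_⟩, ?_⟩
    · rw [LinearPMap.mem_kerSub, LinearPMap.map_sub]
      simp only [Submodule.coe_sub, smul_sub]
      rw [sub_eq_iff_eq_add] at he
      rw [he]; abel
    · have : T.Γ₁ ⟨_, hA⟩ = 0 := hK
      simp only [Prod.mk.injEq] at hf
      rw [LinearMap.domRestrict_apply, map_sub, this, sub_zero, hf.1]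

/-- The inverse of `Γ₁ : ker (A - z) → G` as a linear map with values in `dom A`. -/
def gammaLin (hz : z ∈ T.opZero.resolventSet) : G →ₗ[ℂ] A.domain :=
  (A.kerSub z).subtype ∘ₗ
    (LinearEquiv.ofBijective (T.Γ₁.domRestrict (A.kerSub z)) (T.bijective_restrict hz)).symm

theorem gammaLin_mem (hz : z ∈ T.opZero.resolventSet) (x : G) :
    T.gammaLin hz x ∈ A.kerSub z := by
  simp [gammaLin]

theorem Γ₁_gammaLin (hz : z ∈ T.opZero.resolventSet) (x : G) :
    T.Γ₁ (T.gammaLin hz x) = x :=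
  (LinearEquiv.ofBijective (T.Γ₁.domRestrict (A.kerSub z))
    (T.bijective_restrict hz)).apply_symm_apply x

theorem continuous_gammaLin [CompleteSpace H] [CompleteSpace G]
    (hz : z ∈ T.opZero.resolventSet) :
    Continuous (A.domain.subtype ∘ₗ T.gammaLin hz) := by
  refine LinearMap.continuous_of_seq_closed_graph _ fun u x y hu hy => ?_
  have hg : ∀ n, ((T.gammaLin hz (u n) : H), z • (T.gammaLin hz (u n) : H)) ∈ A.graph := by
    intro n
    rw [← LinearPMap.mem_kerSub.1 (T.gammaLin_mem hz (u n))]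
    exact A.mem_graph _
  have hlim : (y, z • y) ∈ A.graph :=
    T.isClosed.mem_of_tendsto (hy.prodMk_nhds (hy.const_smul z))
      (Filter.Eventually.of_forall hg)
  obtain ⟨f, hf1, hf2⟩ := A.mem_graph_iff.1 hlim
  simp only at hf1 hf2
  subst hf1
  obtain ⟨g, hgg⟩ := T.surjective (0, T.Γ₁ f - x)
  simp only [Prod.mk.injEq] at hgg
  have key : ∀ k : A.domain, k ∈ A.kerSub z →
      inner ℂ (k : H) (A g) - inner ℂ (z • (k : H)) (g : H) =
        inner ℂ (T.Γ₁ k) (T.Γ₁ f - x) := by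
    intro k hk
    have := T.green k g
    rw [LinearPMap.mem_kerSub.1 hk, hgg.1, hgg.2, inner_zero_right, sub_zero] at this
    exact this
  have hfk : f ∈ A.kerSub z := LinearPMap.mem_kerSub.2 hf2
  have l1 : Filter.Tendsto (fun n => inner ℂ (T.gammaLin hz (u n) : H) (A g) -
      inner ℂ (z • (T.gammaLin hz (u n) : H)) (g : H)) Filter.atTop
      (nhds (inner ℂ (f : H) (A g) - inner ℂ (z • (f : H)) (g : H))) :=
    (hy.inner tendsto_const_nhds).sub ((hy.const_smul z).inner tendsto_const_nhds)
  have l2 : Filter.Tendsto (fun n => inner ℂ (u n) (T.Γ₁ f - x)) Filter.atTop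
      (nhds (inner ℂ x (T.Γ₁ f - x))) := hu.inner tendsto_const_nhds
  have e : inner ℂ (T.Γ₁ f) (T.Γ₁ f - x) = inner ℂ x (T.Γ₁ f - x) := by
    rw [← key f hfk]
    refine tendsto_nhds_unique l1 (l2.congr fun n => ?_)
    rw [key _ (T.gammaLin_mem hz (u n)), Γ₁_gammaLin]
  have e2 : T.Γ₁ f - x = 0 := by
    rw [← inner_self_eq_zero (𝕜 := ℂ), inner_sub_left, e, sub_self]
  have e3 := T.eq_zero_of_mem_ker hz (f - T.gammaLin hz x)
    (Submodule.sub_mem _ hfk (T.gammaLin_mem hz x)) (by rw [map_sub, Γ₁_gammaLin, e2])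
  rw [sub_eq_zero] at e3
  simp [← e3]

/-- The Krein `Γ`-field induced by the boundary triple: `γ(z) : G → ker (A - z) ⊆ H` is the
(bounded) inverse of the restriction of `Γ₁` to `ker (A - z)`. -/
def gammaField [CompleteSpace H] [CompleteSpace G]
    (z : ℂ) (hz : z ∈ T.opZero.resolventSet) : G →L[ℂ] H :=
  ⟨A.domain.subtype ∘ₗ T.gammaLin hz, T.continuous_gammaLin hz⟩

theorem continuous_qLin [CompleteSpace H] [CompleteSpace G]
    (hz : z ∈ T.opZero.resolventSet) : Continuous (T.Γ₂ ∘ₗ T.gammaLin hz) := by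
  refine LinearMap.continuous_of_seq_closed_graph _ fun u x y hu hy => ?_
  obtain ⟨g, hgg⟩ := T.surjective (y - T.Γ₂ (T.gammaLin hz x), 0)
  simp only [Prod.mk.injEq] at hgg
  have hc : Filter.Tendsto (fun n => (T.gammaLin hz (u n) : H)) Filter.atTop
      (nhds (T.gammaLin hz x : H)) := ((T.continuous_gammaLin hz).tendsto x).comp hu
  have key : ∀ v : G, inner ℂ (T.gammaLin hz v : H) (A g) -
      inner ℂ (z • (T.gammaLin hz v : H)) (g : H) =
        - inner ℂ (T.Γ₂ (T.gammaLin hz v)) (y - T.Γ₂ (T.gammaLin hz x)) := by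
    intro v
    have := T.green (T.gammaLin hz v) g
    rw [LinearPMap.mem_kerSub.1 (T.gammaLin_mem hz v), hgg.1, hgg.2, inner_zero_right,
      zero_sub] at this
    exact this
  have l1 : Filter.Tendsto (fun n => inner ℂ (T.gammaLin hz (u n) : H) (A g) -
      inner ℂ (z • (T.gammaLin hz (u n) : H)) (g : H)) Filter.atTop
      (nhds (inner ℂ (T.gammaLin hz x : H) (A g) -
        inner ℂ (z • (T.gammaLin hz x : H)) (g : H))) :=
    (hc.inner tendsto_const_nhds).sub ((hc.const_smul z).inner tendsto_const_nhds)
  have l2 : Filter.Tendsto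
      (fun n => - inner ℂ (T.Γ₂ (T.gammaLin hz (u n))) (y - T.Γ₂ (T.gammaLin hz x)))
      Filter.atTop (nhds (- inner ℂ y (y - T.Γ₂ (T.gammaLin hz x)))) :=
    (hy.inner tendsto_const_nhds).neg
  have e := tendsto_nhds_unique l1 (l2.congr fun n => (key (u n)).symm)
  rw [key x, neg_inj] at e
  have e2 : y - T.Γ₂ (T.gammaLin hz x) = 0 := by
    rw [← inner_self_eq_zero (𝕜 := ℂ), inner_sub_left, ← e, sub_self]
  simpa using sub_eq_zero.1 e2

/-- The Krein `𝒬`-function (Weyl function) induced by the boundary triple: the bounded operator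
`Q(z) = Γ₂ γ(z)` in `G`. -/
def qFunction [CompleteSpace H] [CompleteSpace G]
    (z : ℂ) (hz : z ∈ T.opZero.resolventSet) : G →L[ℂ] G :=
  ⟨T.Γ₂ ∘ₗ T.gammaLin hz, T.continuous_qLin hz⟩

/-- The operator `Q(z) - Λ` in `G`, with domain `dom Λ`. -/
def qSub [CompleteSpace H] [CompleteSpace G] (Λ : G →ₗ.[ℂ] G)
    (z : ℂ) (hz : z ∈ T.opZero.resolventSet) : G →ₗ.[ℂ] G :=
  (T.qFunction z hz : G →ₗ[ℂ] G).toPMap ⊤ - Λ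

end BoundaryTriple

end

universe u v

/-! Write `A` for `S*` and fix `z` in the resolvent set of `H⁰`. Every `f ∈ dom A` splits as `f =
(H⁰ - z)⁻¹ h + γ(z) g` with `h = (A - z) f` and `g = Γ₁ f`. Applying `Γ₂` gives `Γ₂ f = δ h + Q(z)
g`, where `δ = Γ₂ (H⁰ - z)⁻¹`. Hence `f ∈ dom H_Λ` exactly when `g ∈ dom Λ` and `δ h = -(Q(z) - Λ)
g`.

For `h = 0` this identifies the kernels through `γ(z)` (`map_gammaField_eigenspace`). For varying
`h` it says that `ran (H_Λ - z)` is the `δ`-preimage of `ran (Q(z) - Λ)`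
(`exists_rangeSub_opRel_eq_comap`). As `δ` is a bounded surjection, one range is everything, or
closed, if and only if the other is. Eigenvalues depend on the kernel alone. Both operators are
closed, so membership in the spectrum depends on kernel and range alone (`mem_resolventSet_iff`).

Isolation in the spectrum is harder: on one side the spectral parameter of `H_Λ` moves, on the other
`E` is frozen in `Q(E) - Λ`. For self-adjoint operators, `mem_specDis_iff` replaces isolation of an
eigenvalue by closedness of the range at that single point, which `δ` transports. The essential
spectrum follows by taking complements. -/

noncomputable section

namespace LinearPMap

variable {H : Type*} [NormedAddCommGroup H] [InnerProductSpace ℂ H]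

/-! ### Kernel and range criteria for closed operators. -/

/-- The range of `A - z`. -/
def rangeSub (A : H →ₗ.[ℂ] H) (z : ℂ) : Submodule ℂ H :=
  LinearMap.range (A.toFun - z • A.domain.subtype)

theorem mem_rangeSub {A : H →ₗ.[ℂ] H} {z : ℂ} {y : H} :
    y ∈ A.rangeSub z ↔ ∃ x : A.domain, A x - z • (x : H) = y := by
  simp [rangeSub, LinearMap.mem_range]

theorem mem_eigenspace {A : H →ₗ.[ℂ] H} {z : ℂ} {y : H} :
    y ∈ A.eigenspace z ↔ ∃ x : A.domain, A x = z • (x : H) ∧ (x : H) = y := by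
  simp only [eigenspace, Submodule.mem_map, mem_kerSub, Submodule.subtype_apply]

theorem specPP_subset_spec {A : H →ₗ.[ℂ] H} : A.specPP ⊆ A.spec := by
  rintro z hz ⟨R, -, h⟩
  refine hz (eq_bot_iff.2 fun y hy => ?_)
  obtain ⟨x, hx, rfl⟩ := mem_eigenspace.1 hy
  have := h x
  rw [hx, sub_self] at this
  exact this.symm.trans (_root_.map_zero R)

/-- A closed operator `A` has `z` in its resolvent set if and only if `A - z` is bijective. -/
theorem mem_resolventSet_iff [CompleteSpace H] {A : H →ₗ.[ℂ] H} (hA : A.IsClosed) {z : ℂ} :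
    z ∈ A.resolventSet ↔ A.eigenspace z = ⊥ ∧ A.rangeSub z = ⊤ := by
  constructor
  · intro hz
    refine ⟨by_contra fun h => specPP_subset_spec h hz, eq_top_iff.2 fun y _ => ?_⟩
    obtain ⟨R, h, -⟩ := hz
    obtain ⟨h, e⟩ := h y
    exact mem_rangeSub.2 ⟨_, e⟩
  · rintro ⟨h1, h2⟩
    have hbij : Function.Bijective (A.toFun - z • A.domain.subtype) := by
      constructor
      · rw [injective_iff_map_eq_zero]
        intro x hx
        have : (x : H) ∈ A.eigenspace z := mem_eigenspace.2 ⟨x, mem_kerSub.1 hx, rfl⟩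
        rw [h1, Submodule.mem_bot] at this
        exact Subtype.ext this
      · exact LinearMap.range_eq_top.1 h2
    let e := LinearEquiv.ofBijective _ hbij
    have he : ∀ x : A.domain, e x = A x - z • (x : H) := fun x => rfl
    have hes : ∀ y : H, A (e.symm y) = y + z • (e.symm y : H) := fun y => by
      rw [← sub_eq_iff_eq_add, ← he, e.apply_symm_apply]
    -- Closed graph theorem: the graph of the inverse is closed because that of `A` is.
    have hcont : Continuous (A.domain.subtype ∘ₗ (e.symm : H →ₗ[ℂ] A.domain)) := by
      refine LinearMap.continuous_of_seq_closed_graph _ fun u x y hu hy => ?_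
      have hlim : (y, x + z • y) ∈ A.graph := by
        refine _root_.IsClosed.mem_of_tendsto hA (hy.prodMk_nhds (hu.add (hy.const_smul z)))
          (Filter.Eventually.of_forall fun n => ?_)
        simp only [Function.comp_apply, LinearMap.comp_apply, Submodule.subtype_apply,
          LinearEquiv.coe_coe]
        rw [← hes]
        exact A.mem_graph _
      obtain ⟨f, hf1, hf2⟩ := A.mem_graph_iff.1 hlim
      simp only at hf1 hf2
      have : e f = x := by rw [he, hf2, hf1]; abel
      simp [← this, hf1]
    refine ⟨⟨_, hcont⟩, fun y => ⟨(e.symm y).2, ?_⟩, fun x => ?_⟩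
    · change A (e.symm y) - z • (e.symm y : H) = y
      rw [hes]; abel
    · change (e.symm (e x) : H) = x
      rw [e.symm_apply_apply]

/-- A bounded operator minus a closed operator is closed. -/
theorem IsClosed.toPMap_sub {A : H →ₗ.[ℂ] H} (hA : A.IsClosed) (B : H →L[ℂ] H) :
    ((B : H →ₗ[ℂ] H).toPMap ⊤ - A).IsClosed := by
  have : (((B : H →ₗ[ℂ] H).toPMap ⊤ - A).graph : Set (H × H)) =
      (fun p : H × H => (p.1, B p.1 - p.2)) ⁻¹' A.graph := by
    ext ⟨x, y⟩
    simp only [SetLike.mem_coe, Set.mem_preimage, mem_graph_iff]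
    constructor
    · rintro ⟨f, rfl, rfl⟩
      refine ⟨⟨f, f.2.2⟩, rfl, ?_⟩
      rw [sub_apply]
      simp
    · rintro ⟨f, rfl, h⟩
      refine ⟨⟨f, Submodule.mem_top, f.2⟩, rfl, ?_⟩
      rw [sub_apply]
      simp [h]
  unfold LinearPMap.IsClosed
  rw [this]
  exact _root_.IsClosed.preimage (by fun_prop) hA

/-- Since `dom (B - A)` is `⊤ ⊓ dom A`, its elements must be repackaged as elements of `dom A`. The
free predicate `p` serves ranges and eigenspaces alike. -/
theorem exists_toPMap_sub_apply {A : H →ₗ.[ℂ] H} (B : H →L[ℂ] H)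
    {p : H → H → Prop} :
    (∃ x : ((B : H →ₗ[ℂ] H).toPMap ⊤ - A).domain,
      p x (((B : H →ₗ[ℂ] H).toPMap ⊤ - A) x)) ↔ ∃ x : A.domain, p x (B x - A x) := by
  constructor
  · rintro ⟨f, h⟩
    refine ⟨⟨f, f.2.2⟩, ?_⟩
    rw [sub_apply] at h
    simpa using h
  · rintro ⟨f, h⟩
    refine ⟨⟨f, Submodule.mem_top, f.2⟩, ?_⟩
    rw [sub_apply]
    simpa using h

theorem mem_rangeSub_toPMap_sub {A : H →ₗ.[ℂ] H} {B : H →L[ℂ] H} {y : H} :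
    y ∈ ((B : H →ₗ[ℂ] H).toPMap ⊤ - A).rangeSub 0 ↔ ∃ x : A.domain, B x - A x = y := by
  rw [mem_rangeSub]
  simpa using exists_toPMap_sub_apply (A := A) B (p := fun _ v => v = y)

theorem mem_eigenspace_toPMap_sub {A : H →ₗ.[ℂ] H} {B : H →L[ℂ] H} {y : H} :
    y ∈ ((B : H →ₗ[ℂ] H).toPMap ⊤ - A).eigenspace 0 ↔
      ∃ x : A.domain, B x - A x = 0 ∧ (x : H) = y := by
  rw [mem_eigenspace]
  simpa using exists_toPMap_sub_apply (A := A) B (p := fun x v => v = 0 ∧ x = y)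

/-! ### Self-adjoint operators: symmetry, maximality, orthogonality of range and kernel. -/

theorem inner_apply_eq_of_isSelfAdjoint [CompleteSpace H] {A : H →ₗ.[ℂ] H} (hA : IsSelfAdjoint A)
    (x y : A.domain) : inner ℂ (A x) (y : H) = inner ℂ (x : H) (A y) := by
  have h := adjoint_isFormalAdjoint hA.dense_domain
  rw [isSelfAdjoint_def.1 hA] at h
  exact h x y

/-- A maximality criterion for self-adjointness. -/
theorem isSelfAdjoint_of_forall [CompleteSpace H] {A : H →ₗ.[ℂ] H}
    (hd : Dense (A.domain : Set H))
    (hs : ∀ x y : A.domain, inner ℂ (A x) (y : H) = inner ℂ (x : H) (A y))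
    (hm : ∀ f h : H, (∀ g : A.domain, inner ℂ h (g : H) = inner ℂ f (A g)) → f ∈ A.domain) :
    IsSelfAdjoint A := by
  rw [isSelfAdjoint_def]
  have hle : A ≤ A.adjoint := IsFormalAdjoint.le_adjoint hd hs
  refine (eq_of_le_of_domain_eq hle (le_antisymm hle.1 fun f hf => ?_)).symm
  exact hm f (A.adjoint ⟨f, hf⟩) fun g => adjoint_isFormalAdjoint hd ⟨f, hf⟩ g

theorem mem_domain_of_isSelfAdjoint [CompleteSpace H] {A : H →ₗ.[ℂ] H} (hA : IsSelfAdjoint A)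
    {f h : H} (hfh : ∀ g : A.domain, inner ℂ h (g : H) = inner ℂ f (A g)) :
    ∃ x : A.domain, (x : H) = f ∧ A x = h := by
  have hf : f ∈ A.adjoint.domain := mem_adjoint_domain_of_exists f ⟨h, hfh⟩
  have h2 := adjoint_apply_eq hA.dense_domain ⟨f, hf⟩ hfh
  have hg : (f, h) ∈ A.adjoint.graph := A.adjoint.mem_graph_iff.2 ⟨_, rfl, h2⟩
  rw [isSelfAdjoint_def.1 hA] at hg
  exact A.mem_graph_iff.1 hg

/-- Eigenvalues of a self-adjoint operator are real. -/
theorem conj_eq_of_mem_specPP [CompleteSpace H] {A : H →ₗ.[ℂ] H} (hA : IsSelfAdjoint A)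
    {z : ℂ} (hz : z ∈ A.specPP) : starRingEnd ℂ z = z := by
  obtain ⟨y, hy, h0⟩ := Submodule.exists_mem_ne_zero_of_ne_bot hz
  obtain ⟨x, hx, rfl⟩ := mem_eigenspace.1 hy
  have := inner_apply_eq_of_isSelfAdjoint hA x x
  rw [hx, inner_smul_left, inner_smul_right] at this
  exact mul_right_cancel₀ (inner_self_ne_zero.2 h0) this

/-- Orthogonality of `f` to the range means `⟨f, A g⟩ = ⟨z̄ f, g⟩` for all `g ∈ dom A`, that is, `f
∈ dom A*` with `A* f = z̄ f`. -/
theorem orthogonal_rangeSub [CompleteSpace H] {A : H →ₗ.[ℂ] H} (hA : IsSelfAdjoint A) (z : ℂ) :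
    (A.rangeSub z)ᗮ = A.eigenspace (starRingEnd ℂ z) := by
  ext f
  rw [Submodule.mem_orthogonal', mem_eigenspace]
  constructor
  · intro h
    obtain ⟨x, rfl, hx⟩ := mem_domain_of_isSelfAdjoint hA (f := f) (h := starRingEnd ℂ z • f)
      fun g => by
        have := h _ (mem_rangeSub.2 ⟨g, rfl⟩)
        rw [inner_sub_right, inner_smul_right, sub_eq_zero] at this
        rw [inner_smul_left, this]; simp
    exact ⟨x, hx, rfl⟩
  · rintro ⟨x, hx, rfl⟩ y hy
    obtain ⟨g, rfl⟩ := mem_rangeSub.1 hy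
    rw [inner_sub_right, ← inner_apply_eq_of_isSelfAdjoint hA, hx, inner_smul_left, inner_smul_right]
    simp

/-! ### Isolated points of the spectrum and closed ranges. -/

/-- If `A - z` has closed range, then `z` is not an accumulation point of the spectrum. -/
theorem isolated_of_isClosed_rangeSub [CompleteSpace H] {A : H →ₗ.[ℂ] H} (hA : IsSelfAdjoint A)
    {z : ℂ} (hz : starRingEnd ℂ z = z) (hr : _root_.IsClosed (A.rangeSub z : Set H)) :
    ∃ ε : ℝ, 0 < ε ∧ ∀ w ∈ A.spec, dist w z < ε → w = z := by
  have hK : (A.rangeSub z)ᗮ = A.eigenspace z := by rw [orthogonal_rangeSub hA, hz]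
  have hKc : _root_.IsClosed (A.eigenspace z : Set H) := hK ▸ Submodule.isClosed_orthogonal _
  have : CompleteSpace (A.eigenspace z) := hKc.completeSpace_coe
  have : CompleteSpace (A.rangeSub z) := hr.completeSpace_coe
  have hK' : (A.eigenspace z)ᗮ = A.rangeSub z := by
    rw [← hK, Submodule.orthogonal_orthogonal]
  set P : H →L[ℂ] H := (A.eigenspace z).starProjection with hP
  have hPmem : ∀ y, P y ∈ A.eigenspace z := fun y => Submodule.starProjection_apply_mem _ y
  have hPid : ∀ y ∈ A.eigenspace z, P y = y := fun y hy =>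
    Submodule.starProjection_eq_self_iff.2 hy
  have hPdom : ∀ y, ∃ x : A.domain, A x = z • (x : H) ∧ (x : H) = P y := fun y =>
    mem_eigenspace.1 (hPmem y)
  have hPr : ∀ y ∈ A.rangeSub z, P y = 0 := fun y hy => by
    rw [← hK'] at hy
    exact (Submodule.starProjection_apply_eq_zero_iff _).2 hy
  have hPA : ∀ x : A.domain, P (A x) = z • P x := fun x => by
    have := hPr _ (mem_rangeSub.2 ⟨x, rfl⟩)
    rwa [_root_.map_sub, _root_.map_smul, sub_eq_zero] at this
  -- `P + z - A` is the identity on the eigenspace and `z - A` on its orthogonal complement, the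
  -- range. It is therefore bijective, and `R` is its bounded inverse.
  obtain ⟨R, hR1, -⟩ : (0 : ℂ) ∈
      (((P + z • ContinuousLinearMap.id ℂ H : H →L[ℂ] H) : H →ₗ[ℂ] H).toPMap ⊤ -
        A).resolventSet := by
    rw [mem_resolventSet_iff (hA.isClosed.toPMap_sub _)]
    constructor
    · rw [eq_bot_iff]
      intro y hy
      obtain ⟨x, hx, rfl⟩ := mem_eigenspace_toPMap_sub.1 hy
      simp only [_root_.add_apply, _root_.smul_apply,
        ContinuousLinearMap.id_apply] at hx
      have h1 : P x = 0 := by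
        have := congrArg P hx
        rw [_root_.map_sub, _root_.map_add, hPA, _root_.map_smul, hPid _ (hPmem _)] at this
        simpa using this
      rw [h1, zero_add, sub_eq_zero] at hx
      rw [Submodule.mem_bot, ← h1, hPid _ (mem_eigenspace.2 ⟨x, hx.symm, rfl⟩)]
    · rw [eq_top_iff]
      intro y _
      have : y - P y ∈ A.rangeSub z := by
        rw [← hK']; exact Submodule.sub_starProjection_mem_orthogonal _
      obtain ⟨x, hx⟩ := mem_rangeSub.1 this
      obtain ⟨p, hp, hp'⟩ := hPdom x
      obtain ⟨q, hq, hq'⟩ := hPdom y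
      -- `-x` yields `y - P y - P x`; `p = P x` cancels the last term and `q = P y` supplies the
      -- missing one.
      refine mem_rangeSub_toPMap_sub.2 ⟨-x + p + q, ?_⟩
      rw [map_add, map_add, map_neg, hp, hq, hp', hq', sub_eq_iff_eq_add.1 hx]
      simp [hp', hq', hPid _ (hPmem _)]
      abel
  have hR : ∀ y, ∃ x : A.domain, (x : H) = R y ∧ A x = P (R y) + z • R y - y := fun y => by
    obtain ⟨h, e⟩ := hR1 y
    refine ⟨⟨R y, h.2⟩, rfl, ?_⟩
    rw [sub_apply] at e
    rw [← sub_eq_zero]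
    rw [← sub_eq_zero] at e
    simp at e
    rw [← neg_eq_zero, ← e]
    abel
  have hPR : ∀ y, P (R y) = P y := fun y => by
    obtain ⟨x, hx, hx'⟩ := hR y
    have := hPA x
    rw [hx', hx, _root_.map_sub, _root_.map_add, _root_.map_smul, hPid _ (hPmem _), sub_eq_iff_eq_add, add_comm,
      add_left_cancel_iff] at this
    exact this
  -- The radius gives both `‖(z - w) R‖ < 1`, for the Neumann series, and `‖z - w‖ < 1`, which
  -- forces `P u = 0` below.
  have hsurj : ∀ w : ℂ, w ≠ z → dist w z < (‖R‖ + 1)⁻¹ → A.rangeSub w = ⊤ := by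
    intro w hwz hw
    have hwz' : z - w ≠ 0 := sub_ne_zero.2 hwz.symm
    rw [dist_eq_norm, ← norm_neg, neg_sub] at hw
    have hpos : 0 < ‖R‖ + 1 := by positivity
    have h1 : ‖(z - w) • R‖ < 1 := by
      rw [norm_smul]
      calc ‖z - w‖ * ‖R‖ ≤ ‖z - w‖ * (‖R‖ + 1) := by gcongr; linarith
        _ < (‖R‖ + 1)⁻¹ * (‖R‖ + 1) := by gcongr
        _ = 1 := inv_mul_cancel₀ hpos.ne'
    have h2 : ‖z - w‖ < 1 := hw.trans_le (inv_le_one_of_one_le₀ (by linarith [norm_nonneg R]))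
    obtain ⟨U, hU⟩ := (isUnit_one_sub_of_norm_lt_one h1).exists_right_inv
    rw [eq_top_iff]
    intro y _
    obtain ⟨u, hu⟩ : ∃ u, u - (z - w) • R u = y - P y :=
      ⟨U (y - P y), congrArg (fun B : H →L[ℂ] H => B (y - P y)) hU⟩
    have hPu : P u = 0 := by
      have h3 := congrArg P hu
      rw [_root_.map_sub, _root_.map_smul, hPR, _root_.map_sub, hPid _ (hPmem y), sub_self] at h3
      have h4 : (1 - (z - w)) • P u = 0 := by rw [sub_smul, one_smul, h3]
      refine (smul_eq_zero.1 h4).resolve_left fun h5 => ?_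
      rw [← sub_eq_zero.1 h5] at h2
      simp at h2
    obtain ⟨x, hx, hx'⟩ := hR u
    obtain ⟨p, hp, hp'⟩ := hPdom y
    -- `-x = -R u` solves for `y - P y`; on the eigenspace `A - w` is multiplication by `z - w`.
    refine mem_rangeSub.2 ⟨-x + (z - w)⁻¹ • p, ?_⟩
    rw [map_add, map_neg, map_smul, hx', hp, hPR, hPu]
    simp only [Submodule.coe_add, Submodule.coe_neg, Submodule.coe_smul, hx, hp']
    have h6 : (z - w)⁻¹ • z • P y - w • (z - w)⁻¹ • P y = P y := by
      rw [smul_comm w, ← smul_sub, ← sub_smul, inv_smul_smul₀ hwz']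
    have h7 : u - (z • R u - w • R u) = y - P y := by rw [← sub_smul]; exact hu
    calc _ = (u - (z • R u - w • R u)) + ((z - w)⁻¹ • z • P y - w • (z - w)⁻¹ • P y) := by
            rw [smul_add, smul_neg]; abel
      _ = y := by rw [h6, h7]; abel
  refine ⟨(‖R‖ + 1)⁻¹, by positivity, fun w hw hwz => ?_⟩
  by_contra hne
  refine hw ((mem_resolventSet_iff hA.isClosed).2 ⟨?_, hsurj w hne hwz⟩)
  -- Injectivity at `w` is dense range at `w̄`, which is as close to the real point `z` as `w`.
  have hc := orthogonal_rangeSub hA (starRingEnd ℂ w)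
  rw [Complex.conj_conj] at hc
  rw [← hc, hsurj, Submodule.top_orthogonal_eq_bot]
  · intro h
    exact hne (by rw [← Complex.conj_conj w, h, hz])
  · rwa [← hz, Complex.dist_conj_conj]

/-- If a bounded operator has a bounded generalized inverse, its range is closed. -/
theorem isClosed_range_of_mul_mul_eq {C D : H →L[ℂ] H} (h : C * D * C = C) :
    _root_.IsClosed (Set.range C) := by
  have : Set.range C = {y | C (D y) = y} := by
    ext y
    constructor
    · rintro ⟨x, rfl⟩
      exact congrArg (fun B : H →L[ℂ] H => B x) h
    · intro hy
      exact ⟨D y, hy⟩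
  rw [this]
  exact isClosed_eq (by fun_prop) (by fun_prop)

/-- If a point is isolated in the spectrum of a normal bounded operator `R`, or does not belong
to it, then `R - μ` has closed range. -/
theorem isClosed_range_sub_of_isolated [CompleteSpace H] {R : H →L[ℂ] H} (hR : IsStarNormal R)
    {μ : ℂ} (h : ∀ᶠ t in nhds μ, t ∈ spectrum ℂ R → t = μ) :
    _root_.IsClosed (Set.range (R - algebraMap ℂ (H →L[ℂ] H) μ)) := by
  classical
  -- Isolation of `μ` makes `g` continuous on the spectrum, and `(t - μ) g(t) (t - μ) = t - μ`, so
  -- `cfc g R` is a generalized inverse.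
  let g : ℂ → ℂ := fun t => if t = μ then 0 else (t - μ)⁻¹
  have hg : ContinuousOn g (spectrum ℂ R) := by
    intro t ht
    by_cases htm : t = μ
    · subst htm
      refine (continuousWithinAt_const (b := (0 : ℂ))).congr_of_eventuallyEq ?_ (by simp [g])
      filter_upwards [nhdsWithin_le_nhds h, self_mem_nhdsWithin] with s hs hs'
      simp [g, hs hs']
    · have : ContinuousAt (fun s : ℂ => (s - μ)⁻¹) t :=
        (continuousAt_id.sub continuousAt_const).inv₀ (sub_ne_zero.2 htm)
      refine (this.congr ?_).continuousWithinAt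
      filter_upwards [isOpen_ne.mem_nhds htm] with s hs
      simp only [g, if_neg hs]
  have hf : ContinuousOn (fun t : ℂ => t - μ) (spectrum ℂ R) := by fun_prop
  have hC : cfc (fun t : ℂ => t - μ) R = R - algebraMap ℂ (H →L[ℂ] H) μ := by
    rw [cfc_sub (fun t : ℂ => t) (fun _ => μ) R, cfc_id' ℂ R, cfc_const μ R]
  refine isClosed_range_of_mul_mul_eq (D := cfc g R) ?_
  rw [← hC, ← cfc_mul _ _ R hf hg, ← cfc_mul (fun t => (t - μ) * g t) _ R (hf.mul hg) hf]
  refine cfc_congr fun t _ => ?_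
  by_cases htm : t = μ
  · simp [htm]
  · simp [g, htm, mul_inv_cancel₀ (sub_ne_zero.2 htm)]

theorem resolvent_sub [CompleteSpace H] {A : H →ₗ.[ℂ] H} {w w' : ℂ} {R R' : H →L[ℂ] H}
    (hR : ∀ x : A.domain, R (A x - w • (x : H)) = x)
    (hR' : ∀ y : H, ∃ h : R' y ∈ A.domain, A ⟨R' y, h⟩ - w' • R' y = y) :
    R' - R = (w' - w) • (R * R') := by
  ext y
  obtain ⟨h, e⟩ := hR' y
  have e2 := hR ⟨_, h⟩
  have e3 : A ⟨R' y, h⟩ - w • R' y = y + (w' - w) • R' y := by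
    rw [sub_eq_iff_eq_add.1 e, sub_smul]; abel
  simp only at e2
  rw [e3, _root_.map_add, _root_.map_smul] at e2
  change R' y - R y = (w' - w) • R (R' y)
  rw [sub_eq_iff_eq_add', e2]

/-- Spectral mapping for the resolvent. -/
theorem notMem_spectrum_resolvent [CompleteSpace H] {A : H →ₗ.[ℂ] H} {w : ℂ} {R : H →L[ℂ] H}
    (hR1 : ∀ y : H, ∃ h : R y ∈ A.domain, A ⟨R y, h⟩ - w • R y = y)
    (hR2 : ∀ x : A.domain, R (A x - w • (x : H)) = x)
    {t : ℂ} (ht : t ≠ 0) (hres : w + t⁻¹ ∈ A.resolventSet) : t ∉ spectrum ℂ R := by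
  obtain ⟨R', h1, h2⟩ := hres
  have e1 := resolvent_sub hR2 h1
  have e2 := resolvent_sub h2 hR1
  rw [add_sub_cancel_left] at e1
  rw [sub_add_cancel_left] at e2
  have hc : R * R' = R' * R := by
    rw [← neg_sub, e1, neg_smul, neg_inj] at e2
    exact smul_right_injective _ (inv_ne_zero ht) e2
  -- An explicit inverse of `t - R`, verified with the resolvent identity.
  have key : (algebraMap ℂ (H →L[ℂ] H) t - R) * (t⁻¹ • (1 + t⁻¹ • R')) = 1 := by
    have : t⁻¹ • R' - t⁻¹ • R - t⁻¹ • t⁻¹ • (R * R') = 0 := by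
      rw [← smul_sub, e1, sub_self]
    rw [Algebra.algebraMap_eq_smul_one, mul_smul_comm, mul_add, mul_one, mul_smul_comm, sub_mul,
      smul_mul_assoc, one_mul, smul_add, smul_sub, smul_sub, smul_sub, inv_smul_smul₀ ht,
      inv_smul_smul₀ ht]
    rw [← sub_eq_zero, ← this]
    abel
  have comm : Commute (algebraMap ℂ (H →L[ℂ] H) t - R) (t⁻¹ • (1 + t⁻¹ • R')) := by
    exact Commute.sub_left (Algebra.commutes t _)
      (((Commute.one_right R).add_right (Commute.smul_right hc _)).smul_right _)
  exact spectrum.notMem_iff.2 ⟨⟨_, _, key, comm.eq ▸ key⟩, rfl⟩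

/-- If `z` is isolated in the spectrum of a self-adjoint operator `A`, or does not belong to it,
then `A - z` has closed range. -/
theorem isClosed_rangeSub_of_isolated [CompleteSpace H] {A : H →ₗ.[ℂ] H} (hA : IsSelfAdjoint A)
    {z : ℂ} (hz : starRingEnd ℂ z = z) {ε : ℝ} (hε : 0 < ε)
    (h : ∀ w ∈ A.spec, dist w z < ε → w = z) : _root_.IsClosed (A.rangeSub z : Set H) := by
  -- A real point of the resolvent set: realness makes the resolvent `R` self-adjoint.
  set w : ℂ := z + ((ε / 2 : ℝ) : ℂ) with hwdef
  have hzw : w - z = ((ε / 2 : ℝ) : ℂ) := by rw [hwdef]; ring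
  have hne : w - z ≠ 0 := by
    rw [hzw, Complex.ofReal_ne_zero]; positivity
  have hw : w ∈ A.resolventSet := by
    by_contra hw
    refine hne (sub_eq_zero.2 (h w hw ?_))
    rw [dist_eq_norm, hzw, Complex.norm_real, Real.norm_of_nonneg (by positivity)]
    linarith
  have hwr : starRingEnd ℂ w = w := by rw [hwdef, _root_.map_add, hz, Complex.conj_ofReal]
  obtain ⟨R, hR1, hR2⟩ := hw
  have hRsa : IsSelfAdjoint R := by
    rw [ContinuousLinearMap.isSelfAdjoint_iff_isSymmetric]
    intro x y
    obtain ⟨hx, ex⟩ := hR1 x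
    obtain ⟨hy, ey⟩ := hR1 y
    have := inner_apply_eq_of_isSelfAdjoint hA ⟨_, hx⟩ ⟨_, hy⟩
    rw [sub_eq_iff_eq_add.1 ex, sub_eq_iff_eq_add.1 ey, inner_add_left, inner_add_right,
      inner_smul_left, inner_smul_right, hwr, add_left_inj] at this
    exact this.symm
  set μ : ℂ := (z - w)⁻¹ with hμ
  have hzw0 : z - w ≠ 0 := by rw [← neg_sub]; exact neg_ne_zero.2 hne
  have hμ0 : μ ≠ 0 := inv_ne_zero hzw0
  have hiso : ∀ᶠ t in nhds μ, t ∈ spectrum ℂ R → t = μ := by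
    have hlim : Filter.Tendsto (fun t : ℂ => w + t⁻¹) (nhds μ) (nhds z) := by
      have : z = w + μ⁻¹ := by rw [hμ, inv_inv]; ring
      rw [this]
      exact tendsto_const_nhds.add (tendsto_inv₀ hμ0)
    filter_upwards [hlim (Metric.ball_mem_nhds z hε), isOpen_ne.mem_nhds hμ0] with t ht ht0 hts
    have h1 : w + t⁻¹ ∈ A.spec := fun hres => notMem_spectrum_resolvent hR1 hR2 ht0 hres hts
    rw [hμ, ← h _ h1 ht]
    simp
  have hcl := isClosed_range_sub_of_isolated hRsa.isStarNormal hiso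
  convert hcl using 1
  -- The right side equals `(A - z) R y`, so `R - μ` and `A - z` have the same range.
  have hkey : ∀ y : H, (R - algebraMap ℂ (H →L[ℂ] H) μ) ((w - z) • y) = y + (w - z) • R y := by
    intro y
    rw [_root_.map_smul, Algebra.algebraMap_eq_smul_one]
    change (w - z) • (R y - μ • y) = _
    rw [smul_sub, smul_smul, hμ, ← neg_sub z w, neg_mul, mul_inv_cancel₀ hzw0, neg_one_smul]
    abel
  ext v
  simp only [SetLike.mem_coe, mem_rangeSub, Set.mem_range]
  constructor
  · rintro ⟨x, rfl⟩
    refine ⟨(w - z) • (A x - w • (x : H)), ?_⟩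
    rw [hkey, hR2, sub_smul]
    abel
  · rintro ⟨y, rfl⟩
    obtain ⟨hm, e⟩ := hR1 ((w - z)⁻¹ • y)
    refine ⟨⟨_, hm⟩, ?_⟩
    have h2 := hkey ((w - z)⁻¹ • y)
    rw [smul_inv_smul₀ hne] at h2
    rw [h2, sub_eq_iff_eq_add.1 e, sub_smul]
    abel

/-- For self-adjoint operators, an eigenvalue of finite multiplicity belongs to the discrete
spectrum if and only if the corresponding range is closed. -/
theorem mem_specDis_iff [CompleteSpace H] {A : H →ₗ.[ℂ] H} (hA : IsSelfAdjoint A) {z : ℂ} :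
    z ∈ A.specDis ↔ z ∈ A.specPP ∧ FiniteDimensional ℂ (A.eigenspace z) ∧
      _root_.IsClosed (A.rangeSub z : Set H) := by
  refine and_congr_right fun hz => and_congr_right fun _ => ⟨?_, ?_⟩
  · rintro ⟨ε, hε, h⟩
    exact isClosed_rangeSub_of_isolated hA (conj_eq_of_mem_specPP hA hz) hε h
  · exact isolated_of_isClosed_rangeSub hA (conj_eq_of_mem_specPP hA hz)

/-- A bounded symmetric operator minus a self-adjoint operator is self-adjoint. -/
theorem isSelfAdjoint_toPMap_sub [CompleteSpace H] {A : H →ₗ.[ℂ] H} (hA : IsSelfAdjoint A)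
    {B : H →L[ℂ] H} (hB : ∀ x y : H, inner ℂ (B x) y = inner ℂ x (B y)) :
    IsSelfAdjoint ((B : H →ₗ[ℂ] H).toPMap ⊤ - A) := by
  have hdom : ((B : H →ₗ[ℂ] H).toPMap ⊤ - A).domain = A.domain := top_inf_eq _
  have happ : ∀ x : ((B : H →ₗ[ℂ] H).toPMap ⊤ - A).domain,
      ((B : H →ₗ[ℂ] H).toPMap ⊤ - A) x = B x - A ⟨x, x.2.2⟩ := fun x => by
    rw [sub_apply]; rfl
  refine isSelfAdjoint_of_forall (hdom ▸ hA.dense_domain) (fun x y => ?_) fun f h hfh => ?_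
  · rw [happ, happ, inner_sub_left, inner_sub_right, hB]
    congr 1
    exact inner_apply_eq_of_isSelfAdjoint hA ⟨x, x.2.2⟩ ⟨y, y.2.2⟩
  · rw [hdom]
    obtain ⟨x, rfl, -⟩ := mem_domain_of_isSelfAdjoint hA (f := f) (h := B f - h) fun g => by
      have := hfh ⟨g, Submodule.mem_top, g.2⟩
      rw [happ, inner_sub_right] at this
      rw [inner_sub_left, this, hB]
      simp
    exact x.2

end LinearPMap

namespace BoundaryTriple

open LinearPMap

variable {H : Type*} [NormedAddCommGroup H] [InnerProductSpace ℂ H] {A : H →ₗ.[ℂ] H}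
  {G : Type*} [NormedAddCommGroup G] [InnerProductSpace ℂ G] (T : BoundaryTriple A G) {z : ℂ}

/-! ### Boundary triples: comparison of `H_Λ - z` with `Q(z) - Λ`. -/

theorem exists_opRel_apply {Λ : G →ₗ.[ℂ] G} {p : H → H → Prop} :
    (∃ f : (T.opRel Λ).domain, p f (T.opRel Λ f)) ↔
      ∃ f : A.domain, (∃ g : Λ.domain, (g : G) = T.Γ₁ f ∧ Λ g = T.Γ₂ f) ∧ p f (A f) := by
  constructor
  · rintro ⟨f, hf⟩
    obtain ⟨hA, hK⟩ := mem_restrictTo_domain.1 f.2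
    refine ⟨⟨f, hA⟩, Λ.mem_graph_iff.1 hK, ?_⟩
    rwa [← show T.opRel Λ f = A ⟨f, hA⟩ from restrictTo_apply f _ rfl]
  · rintro ⟨f, hg, hf⟩
    have hm : (f : H) ∈ (T.opRel Λ).domain :=
      mem_restrictTo_domain.2 ⟨f.2, Λ.mem_graph_iff.2 hg⟩
    refine ⟨⟨f, hm⟩, ?_⟩
    rwa [show T.opRel Λ ⟨f, hm⟩ = A f from restrictTo_apply _ _ rfl]

theorem mem_rangeSub_opRel {Λ : G →ₗ.[ℂ] G} {h : H} :
    h ∈ (T.opRel Λ).rangeSub z ↔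
      ∃ f : A.domain, (∃ g : Λ.domain, (g : G) = T.Γ₁ f ∧ Λ g = T.Γ₂ f) ∧
        A f - z • (f : H) = h := by
  rw [mem_rangeSub]
  exact T.exists_opRel_apply (p := fun x v => v - z • x = h)

theorem mem_eigenspace_opRel {Λ : G →ₗ.[ℂ] G} {h : H} :
    h ∈ (T.opRel Λ).eigenspace z ↔
      ∃ f : A.domain, (∃ g : Λ.domain, (g : G) = T.Γ₁ f ∧ Λ g = T.Γ₂ f) ∧
        A f = z • (f : H) ∧ (f : H) = h := by
  rw [mem_eigenspace]
  exact T.exists_opRel_apply (p := fun x v => v = z • x ∧ x = h)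

/-- The range of `H_Λ - z` is the preimage of the range of `Q(z) - Λ` under the bounded
surjection `Γ₂ (H⁰ - z)⁻¹`. -/
theorem exists_rangeSub_opRel_eq_comap [CompleteSpace H] [CompleteSpace G]
    (hz : z ∈ T.opZero.resolventSet) :
    ∃ δ : H →L[ℂ] G, Function.Surjective δ ∧ ∀ (Λ : G →ₗ.[ℂ] G) (h : H),
      h ∈ (T.opRel Λ).rangeSub z ↔ δ h ∈ (T.qSub Λ z hz).rangeSub 0 := by
  obtain ⟨R, hR1, hR2⟩ := id hz
  have hdom : ∀ y, R y ∈ A.domain := fun y => (mem_restrictTo_domain.1 (hR1 y).1).1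
  let r : H →ₗ[ℂ] A.domain := (R : H →ₗ[ℂ] H).codRestrict A.domain hdom
  have hr : ∀ y, (r y : H) = R y := fun y => rfl
  have hΓ : ∀ y, T.Γ₁ (r y) = 0 := fun y => (mem_restrictTo_domain.1 (hR1 y).1).2
  have hAr : ∀ y, A (r y) = y + z • R y := fun y => by
    obtain ⟨hm, e⟩ := hR1 y
    rw [show T.opZero ⟨_, hm⟩ = A (r y) from restrictTo_apply _ _ rfl] at e
    exact sub_eq_iff_eq_add.1 e
  have hrA : ∀ f : A.domain, T.Γ₁ f = 0 → r (A f - z • (f : H)) = f := fun f hf => by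
    have hm : (f : H) ∈ T.opZero.domain := mem_restrictTo_domain.2 ⟨f.2, hf⟩
    have := hR2 ⟨f, hm⟩
    rw [show T.opZero ⟨f, hm⟩ = A f from restrictTo_apply _ _ rfl] at this
    exact Subtype.ext this
  -- Closed graph theorem: Green's identity against `k` with `Γ₂ k = 0` expresses pairings with `Γ₂
  -- (r v)` through terms continuous in `v`.
  have hcont : Continuous (T.Γ₂ ∘ₗ r) := by
    refine LinearMap.continuous_of_seq_closed_graph _ fun u x y hu hy => ?_
    obtain ⟨k, hk⟩ := T.surjective (y - T.Γ₂ (r x), 0)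
    simp only [Prod.mk.injEq] at hk
    have key : ∀ v : H, inner ℂ (R v) (A k) - inner ℂ (v + z • R v) (k : H) =
        - inner ℂ (T.Γ₂ (r v)) (y - T.Γ₂ (r x)) := by
      intro v
      have := T.green (r v) k
      rwa [hAr, hr, hk.1, hk.2, inner_zero_right, zero_sub] at this
    have hc : Filter.Tendsto (fun n => R (u n)) Filter.atTop (nhds (R x)) :=
      (R.continuous.tendsto x).comp hu
    have l1 : Filter.Tendsto
        (fun n => inner ℂ (R (u n)) (A k) - inner ℂ (u n + z • R (u n)) (k : H)) Filter.atTop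
        (nhds (inner ℂ (R x) (A k) - inner ℂ (x + z • R x) (k : H))) :=
      (hc.inner tendsto_const_nhds).sub ((hu.add (hc.const_smul z)).inner tendsto_const_nhds)
    have l2 : Filter.Tendsto (fun n => - inner ℂ (T.Γ₂ (r (u n))) (y - T.Γ₂ (r x)))
        Filter.atTop (nhds (- inner ℂ y (y - T.Γ₂ (r x)))) :=
      (hy.inner tendsto_const_nhds).neg
    have e := tendsto_nhds_unique l1 (l2.congr fun n => (key (u n)).symm)
    rw [key x, neg_inj] at e
    have e2 : y - T.Γ₂ (r x) = 0 := by
      rw [← inner_self_eq_zero (𝕜 := ℂ), inner_sub_left, ← e, sub_self]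
    exact sub_eq_zero.1 e2
  refine ⟨⟨T.Γ₂ ∘ₗ r, hcont⟩, fun y => ?_, fun Λ h => ?_⟩
  · obtain ⟨f, hf⟩ := T.surjective (0, y)
    simp only [Prod.mk.injEq] at hf
    refine ⟨A f - z • (f : H), ?_⟩
    change T.Γ₂ (r _) = y
    rw [hrA f hf.1, hf.2]
  · change _ ↔ T.Γ₂ (r h) ∈ _
    rw [mem_rangeSub_opRel, qSub, mem_rangeSub_toPMap_sub]
    change _ ↔ ∃ x : Λ.domain, T.Γ₂ (T.gammaLin hz x) - Λ x = T.Γ₂ (r h)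
    constructor
    · rintro ⟨f, ⟨g, hg1, hg2⟩, rfl⟩
      -- `δ h = Γ₂ f - Q g = Λ g - Q g`, whence the sign.
      refine ⟨-g, ?_⟩
      have h1 : r (A f - z • (f : H)) = f - T.gammaLin hz g := by
        have h2 := mem_kerSub.1 (T.gammaLin_mem hz g)
        have h3 := hrA (f - T.gammaLin hz g) (by rw [_root_.map_sub, Γ₁_gammaLin, hg1, sub_self])
        rw [← h3, A.map_sub, h2]
        congr 1
        simp only [Submodule.coe_sub, smul_sub]
        abel
      rw [h1, _root_.map_sub, Λ.map_neg, hg2, Submodule.coe_neg, _root_.map_neg, _root_.map_neg]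
      abel
    · rintro ⟨g, hg⟩
      refine ⟨r h - T.gammaLin hz g, ⟨-g, ?_, ?_⟩, ?_⟩
      · rw [_root_.map_sub, hΓ, Γ₁_gammaLin, zero_sub, Submodule.coe_neg]
      · rw [_root_.map_sub, ← hg, Λ.map_neg]
        abel
      · rw [A.map_sub, mem_kerSub.1 (T.gammaLin_mem hz g), hAr, Submodule.coe_sub, hr, smul_sub]
        abel

theorem gammaField_injective [CompleteSpace H] [CompleteSpace G]
    (hz : z ∈ T.opZero.resolventSet) : Function.Injective (T.gammaField z hz) := by
  intro x y hxy
  have h : T.gammaLin hz x = T.gammaLin hz y := Subtype.ext hxy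
  rw [← T.Γ₁_gammaLin hz x, h, Γ₁_gammaLin]

theorem map_gammaField_eigenspace [CompleteSpace H] [CompleteSpace G] (Λ : G →ₗ.[ℂ] G)
    (hz : z ∈ T.opZero.resolventSet) :
    ((T.qSub Λ z hz).eigenspace 0).map (T.gammaField z hz : G →ₗ[ℂ] H) =
      (T.opRel Λ).eigenspace z := by
  ext h
  rw [Submodule.mem_map, mem_eigenspace_opRel]
  constructor
  · rintro ⟨y, hy, rfl⟩
    obtain ⟨g, hg, rfl⟩ := mem_eigenspace_toPMap_sub.1 hy
    exact ⟨T.gammaLin hz g, ⟨g, (T.Γ₁_gammaLin hz g).symm, (sub_eq_zero.1 hg).symm⟩,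
      mem_kerSub.1 (T.gammaLin_mem hz g), rfl⟩
  · rintro ⟨f, ⟨g, hg1, hg2⟩, hf, rfl⟩
    have h1 : T.gammaLin hz g = f := (sub_eq_zero.1 <| T.eq_zero_of_mem_ker hz
      (f - T.gammaLin hz g) (Submodule.sub_mem _ (mem_kerSub.2 hf) (T.gammaLin_mem hz g))
      (by rw [_root_.map_sub, Γ₁_gammaLin, hg1, sub_self])).symm
    refine ⟨g, mem_eigenspace_toPMap_sub.2 ⟨g, ?_, rfl⟩, congrArg Subtype.val h1⟩
    change T.Γ₂ (T.gammaLin hz g) - Λ g = 0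
    rw [h1, hg2, sub_self]

/-- `γ(z)` as an isomorphism between the eigenspaces. -/
theorem nonempty_eigenspace_equiv [CompleteSpace H] [CompleteSpace G] (Λ : G →ₗ.[ℂ] G)
    (hz : z ∈ T.opZero.resolventSet) :
    Nonempty ((T.qSub Λ z hz).eigenspace 0 ≃ₗ[ℂ] (T.opRel Λ).eigenspace z) := by
  rw [← T.map_gammaField_eigenspace Λ hz]
  exact ⟨Submodule.equivMapOfInjective _ (T.gammaField_injective hz) _⟩

/-- For real `z` the left side of Green's identity vanishes on `ker (A - z)`. -/
theorem qFunction_symmetric [CompleteSpace H] [CompleteSpace G]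
    (hz : z ∈ T.opZero.resolventSet) (hr : starRingEnd ℂ z = z) (x y : G) :
    inner ℂ (T.qFunction z hz x) y = inner ℂ x (T.qFunction z hz y) := by
  have := T.green (T.gammaLin hz x) (T.gammaLin hz y)
  rw [mem_kerSub.1 (T.gammaLin_mem hz x), mem_kerSub.1 (T.gammaLin_mem hz y), inner_smul_left,
    inner_smul_right, hr, sub_self, Γ₁_gammaLin, Γ₁_gammaLin] at this
  exact (sub_eq_zero.1 this.symm).symm

/-- The extension `H_Λ` is self-adjoint for self-adjoint `Λ`. -/
theorem isSelfAdjoint_opRel [CompleteSpace H] [CompleteSpace G] {S : H →ₗ.[ℂ] H}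
    (hdense : Dense (S.domain : Set H)) (hsymm : S.IsFormalAdjoint S)
    (T : BoundaryTriple S.adjoint G) {Λ : G →ₗ.[ℂ] G} (hΛ : IsSelfAdjoint Λ) :
    IsSelfAdjoint (T.opRel Λ) := by
  have hle : S ≤ S.adjoint := hsymm.le_adjoint hdense
  have hdom : ∀ f : (T.opRel Λ).domain, ∃ (f' : S.adjoint.domain) (g : Λ.domain),
      (f' : H) = f ∧ (g : G) = T.Γ₁ f' ∧ Λ g = T.Γ₂ f' ∧ T.opRel Λ f = S.adjoint f' := fun f => by
    obtain ⟨f', ⟨g, hg1, hg2⟩, h1, h2⟩ := T.exists_opRel_apply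
      (p := fun x v => x = f ∧ v = T.opRel Λ f) |>.1 ⟨f, rfl, rfl⟩
    exact ⟨f', g, h1, hg1, hg2, h2.symm⟩
  have hback : ∀ (f' : S.adjoint.domain) (g : Λ.domain), (g : G) = T.Γ₁ f' → Λ g = T.Γ₂ f' →
      ∃ f : (T.opRel Λ).domain, (f : H) = f' ∧ T.opRel Λ f = S.adjoint f' := fun f' g h1 h2 =>
    T.exists_opRel_apply (p := fun x v => x = f' ∧ v = S.adjoint f') |>.2
      ⟨f', ⟨g, h1, h2⟩, rfl, rfl⟩
  -- `H_Λ` extends `S`: on `dom S` the boundary form vanishes against every `g`, so surjectivity of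
  -- `(Γ₁, Γ₂)` forces both boundary values to be zero.
  have hmin : ∀ s : S.domain, ∃ f : (T.opRel Λ).domain, (f : H) = s ∧ T.opRel Λ f = S s := by
    intro s
    let f : S.adjoint.domain := ⟨s, hle.1 s.2⟩
    have hf : S.adjoint f = S s := (hle.2 (x := s) (y := f) rfl).symm
    have hz : ∀ g : S.adjoint.domain, inner ℂ (T.Γ₁ f) (T.Γ₂ g) = inner ℂ (T.Γ₂ f) (T.Γ₁ g) := by
      intro g
      rw [← sub_eq_zero, ← T.green f g, hf, sub_eq_zero]
      exact ((adjoint_isFormalAdjoint hdense).symm s g).symm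
    have h1 : T.Γ₁ f = 0 := by
      obtain ⟨g, hg⟩ := T.surjective (0, T.Γ₁ f)
      simp only [Prod.mk.injEq] at hg
      have := hz g
      rwa [hg.1, hg.2, inner_zero_right, inner_self_eq_zero] at this
    have h2 : T.Γ₂ f = 0 := by
      obtain ⟨g, hg⟩ := T.surjective (T.Γ₂ f, 0)
      simp only [Prod.mk.injEq] at hg
      have := hz g
      rwa [hg.1, hg.2, inner_zero_right, eq_comm, inner_self_eq_zero] at this
    obtain ⟨k, hk1, hk2⟩ := hback f 0 (by rw [h1]; rfl) (by rw [h2, Λ.map_zero])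
    exact ⟨k, hk1, hk2.trans hf⟩
  refine isSelfAdjoint_of_forall (hdense.mono ?_) (fun x y => ?_) fun f h hfh => ?_
  · intro s hs
    obtain ⟨f, hf, -⟩ := hmin ⟨s, hs⟩
    exact (show (f : H) = s from hf) ▸ f.2
  · obtain ⟨x', g, hx, hg1, hg2, hx'⟩ := hdom x
    obtain ⟨y', k, hy, hk1, hk2, hy'⟩ := hdom y
    have h1 := T.green x' y'
    rw [← hg1, ← hg2, ← hk1, ← hk2, inner_apply_eq_of_isSelfAdjoint hΛ, sub_self,
      sub_eq_zero] at h1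
    rw [hx', hy', ← hx, ← hy, h1]
  · have hfd : ∀ s : S.domain, inner ℂ h (s : H) = inner ℂ f (S s) := fun s => by
      obtain ⟨k, hk1, hk2⟩ := hmin s
      rw [← hk1, ← hk2, hfh]
    let f' : S.adjoint.domain := ⟨f, mem_adjoint_domain_of_exists f ⟨h, hfd⟩⟩
    have hf' : S.adjoint f' = h := adjoint_apply_eq hdense f' hfd
    -- Lifting each `(v, Λ v)` to `dom H_Λ` gives `⟨Γ₂ f, v⟩ = ⟨Γ₁ f, Λ v⟩`; maximality of `Λ` then
    -- puts `(Γ₁ f, Γ₂ f)` in its graph.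
    obtain ⟨u, hu1, hu2⟩ := mem_domain_of_isSelfAdjoint hΛ (f := T.Γ₁ f') (h := T.Γ₂ f')
      fun v => by
        obtain ⟨k, hk⟩ := T.surjective ((v : G), Λ v)
        simp only [Prod.mk.injEq] at hk
        obtain ⟨l, hl1, hl2⟩ := hback k v hk.1.symm hk.2.symm
        have h1 := T.green f' k
        have h2 := hfh l
        rw [hl1, hl2] at h2
        rw [hf', h2, sub_self, hk.1, hk.2, eq_comm, sub_eq_zero] at h1
        exact h1.symm
    obtain ⟨k, hk, -⟩ := hback f' u hu1 hu2
    exact (show (k : H) = f from hk) ▸ k.2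

theorem mem_spec_opRel_iff [CompleteSpace H] [CompleteSpace G] {Λ : G →ₗ.[ℂ] G}
    (hΛ : Λ.IsClosed) (hcl : (T.opRel Λ).IsClosed) (hz : z ∈ T.opZero.resolventSet) :
    z ∈ (T.opRel Λ).spec ↔ 0 ∈ (T.qSub Λ z hz).spec := by
  refine not_congr ?_
  obtain ⟨δ, hδ, hr⟩ := T.exists_rangeSub_opRel_eq_comap hz
  obtain ⟨e⟩ := T.nonempty_eigenspace_equiv Λ hz
  rw [mem_resolventSet_iff hcl, mem_resolventSet_iff (A := T.qSub Λ z hz) (hΛ.toPMap_sub _)]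
  refine and_congr ?_ ?_
  · rw [← Submodule.subsingleton_iff_eq_bot, ← Submodule.subsingleton_iff_eq_bot]
    exact e.symm.toEquiv.subsingleton_congr
  · rw [Submodule.eq_top_iff', Submodule.eq_top_iff', hδ.forall]
    exact forall_congr' (hr Λ)

theorem mem_specPP_opRel_iff [CompleteSpace H] [CompleteSpace G] {Λ : G →ₗ.[ℂ] G}
    (hz : z ∈ T.opZero.resolventSet) :
    z ∈ (T.opRel Λ).specPP ↔ 0 ∈ (T.qSub Λ z hz).specPP := by
  obtain ⟨e⟩ := T.nonempty_eigenspace_equiv Λ hz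
  refine not_congr ?_
  rw [← Submodule.subsingleton_iff_eq_bot, ← Submodule.subsingleton_iff_eq_bot]
  exact e.symm.toEquiv.subsingleton_congr

theorem mem_specDis_opRel_iff [CompleteSpace H] [CompleteSpace G] {Λ : G →ₗ.[ℂ] G} (hΛ : IsSelfAdjoint Λ)
    (hsa : IsSelfAdjoint (T.opRel Λ)) (hz : z ∈ T.opZero.resolventSet) :
    z ∈ (T.opRel Λ).specDis ↔ 0 ∈ (T.qSub Λ z hz).specDis := by
  -- An eigenvalue of `H_Λ` is real, which is what makes `Q(z) - Λ` self-adjoint.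
  by_cases hpp : z ∈ (T.opRel Λ).specPP
  swap
  · exact iff_of_false (fun h => hpp h.1) fun h => hpp ((T.mem_specPP_opRel_iff hz).2 h.1)
  have hQ : IsSelfAdjoint (T.qSub Λ z hz) := isSelfAdjoint_toPMap_sub hΛ
    (T.qFunction_symmetric hz (conj_eq_of_mem_specPP hsa hpp))
  obtain ⟨δ, hδ, hr⟩ := T.exists_rangeSub_opRel_eq_comap hz
  obtain ⟨e⟩ := T.nonempty_eigenspace_equiv Λ hz
  rw [mem_specDis_iff hsa, mem_specDis_iff hQ, ← T.mem_specPP_opRel_iff hz]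
  refine and_congr_right fun _ => and_congr ?_ ?_
  · exact ⟨fun _ => e.symm.finiteDimensional, fun _ => e.finiteDimensional⟩
  -- By the open mapping theorem `δ` is a quotient map, so closedness passes both ways.
  · rw [← (δ.isOpenMap hδ).isQuotientMap δ.continuous hδ |>.isClosed_preimage]
    have : ((T.opRel Λ).rangeSub z : Set H) =
        δ ⁻¹' ((T.qSub Λ z hz).rangeSub 0 : Set G) := Set.ext (hr Λ)
    rw [this]

end BoundaryTriple

end

theorem mainTheorem2
    {H : Type u} [NormedAddCommGroup H] [InnerProductSpace ℂ H] [CompleteSpace H]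
    {G : Type v} [NormedAddCommGroup G] [InnerProductSpace ℂ G] [CompleteSpace G]
    (S : H →ₗ.[ℂ] H) (hdense : Dense (S.domain : Set H)) (hsymm : S.IsFormalAdjoint S)
    (T : BoundaryTriple S.adjoint G)
    (Λ : G →ₗ.[ℂ] G) (hΛ : IsSelfAdjoint Λ) :
    (T.opRel Λ).specPP \ T.opZero.spec =
        {E | ∃ hE : E ∈ T.opZero.resolventSet, 0 ∈ (T.qSub Λ E hE).specPP} ∧
    (T.opRel Λ).specDis \ T.opZero.spec =
        {E | ∃ hE : E ∈ T.opZero.resolventSet, 0 ∈ (T.qSub Λ E hE).specDis} ∧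
    (T.opRel Λ).specEss \ T.opZero.spec =
        {E | ∃ hE : E ∈ T.opZero.resolventSet, 0 ∈ (T.qSub Λ E hE).specEss} ∧
    ∀ (E : ℂ) (hE : E ∈ T.opZero.resolventSet),
      Function.Injective (T.gammaField E hE) ∧
      ((T.qSub Λ E hE).eigenspace 0).map (T.gammaField E hE : G →ₗ[ℂ] H) =
        (T.opRel Λ).eigenspace E ∧
      Cardinal.lift.{u} (Module.rank ℂ ((T.qSub Λ E hE).eigenspace 0)) =
        Cardinal.lift.{v} (Module.rank ℂ ((T.opRel Λ).eigenspace E)) := by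
  have hsa := T.isSelfAdjoint_opRel hdense hsymm hΛ
  have hset : ∀ {X : Set ℂ} {p : ∀ E, E ∈ T.opZero.resolventSet → Prop},
      (∀ E hE, E ∈ X ↔ p E hE) → X \ T.opZero.spec = {E | ∃ hE, p E hE} := by
    intro X p h
    ext E
    simp only [Set.mem_sdiff, LinearPMap.spec, Set.mem_compl_iff, not_not, Set.mem_ofPred_eq]
    exact ⟨fun hE => ⟨hE.2, (h E hE.2).1 hE.1⟩, fun ⟨hE, hp⟩ => ⟨(h E hE).2 hp, hE⟩⟩
  refine ⟨hset fun E hE => T.mem_specPP_opRel_iff hE,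
    hset fun E hE => T.mem_specDis_opRel_iff hΛ hsa hE,
    hset fun E hE => and_congr (T.mem_spec_opRel_iff hΛ.isClosed hsa.isClosed hE)
      (not_congr (T.mem_specDis_opRel_iff hΛ hsa hE)),
    fun E hE => ⟨T.gammaField_injective hE, T.map_gammaField_eigenspace Λ hE, ?_⟩⟩
  obtain ⟨e⟩ := T.nonempty_eigenspace_equiv Λ hE
  exact e.lift_rank_eq
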